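/- Let $K$ be a field, $S=K[x_1,\dots,x_n]$, and let $I\subset S$ be a strongly stable ideal, i.e. a monomial ideal such that whenever $m$ is a minimal monomial generator of $I$, $x_i\mid m$ and $j<i$, then $(x_j/x_i)\,m\in I$. For a tuple $\mathbf a=(a_1,\dots,a_t)$ of positive integers with $1\le t\le n$, put $\mathfrak m^{\mathbf a}:=(x_1^{a_1},\dots,x_t^{a_t})$, $t(\mathbf a):=t$ and $e(\mathbf a):=a_t$. Let $$I=\bigcap_{\mathbf a\in E}\mathfrak m^{\mathbf a}$$ be the irredundant irreducible decomposition of $I$, where $E$ is a finite set of such tuples. For a homogeneous ideal $J\subset S$, let $\deg(S/J)$ denote the degree (multiplicity) of $S/J$, i.e. $d!$ times the leading coefficient of the polynomial in $k$, of degree $d$, that agrees with $\sum_{j\le k}\dim_K (S/J)_j$ for all large $k$ (and $0$ if $J=S$). The arithmetic degree of $S/I$ and its $i$-th part are $$\operatorname{adeg}(S/I)=\sum_{\mathfrak p\in\operatorname{Ass}(S/I)}\operatorname{mult}_{S/I}(\mathfrak p)\,\deg(S/\mathfrak p),\qquad \operatorname{adeg}_i(S/I)=\sum_{\substack{\mathfrak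 p\in\operatorname{Ass}(S/I)\\ \dim S/\mathfrak p=i}}\operatorname{mult}_{S/I}(\mathfrak p)\,\deg(S/\mathfrak p),$$ where $\operatorname{mult}_{S/I}(\mathfrak p)$ is the length of the $S_{\mathfrak p}$-module $H^0_{\mathfrak pS_{\mathfrak p}}\bigl((S/I)_{\mathfrak p}\bigr)$. Then for every $i\ge 0$ $$\operatorname{adeg}_i(S/I)=\sum_{\substack{\mathbf a\in E\\ t(\mathbf a)=n-i}}e(\mathbf a).$$ Consequently $$\operatorname{adeg}(S/I)=\sum_{\mathbf a\in E}e(\mathbf a)\qquad\text{and}\qquad \deg(S/I)=\sum_{\substack{\mathbf a\in E\\ t(\mathbf a)=\operatorname{ht}(I)}}e(\mathbf a).$$ -/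

import Mathlib

namespace StronglyStable

open MvPolynomial

section Ideals

variable {K : Type*} [Field K] {n : ℕ}

/-- An ideal of `K[x₁, …, xₙ]` generated by monomials. -/
def IsMonomialIdeal (I : Ideal (MvPolynomial (Fin n) K)) : Prop :=
  ∃ s : Set (Fin n →₀ ℕ), I = Ideal.span ((fun u => monomial u (1 : K)) '' s)

/-- The exponents of the minimal monomial generators of a monomial ideal, that is, of the monomials
in `I` that are minimal with respect to divisibility. -/
def minGens (I : Ideal (MvPolynomial (Fin n) K)) : Set (Fin n →₀ ℕ) :=
  {u | Minimal (fun v => monomial v (1 : K) ∈ I) u}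

/-- `I` is a monomial ideal, and whenever `x^u` is a minimal monomial generator divisible by `xᵢ`
and `j < i`, the monomial `(xⱼ / xᵢ) x^u` lies in `I`. -/
def IsStronglyStable (I : Ideal (MvPolynomial (Fin n) K)) : Prop :=
  IsMonomialIdeal I ∧
    ∀ u ∈ minGens I, ∀ i j : Fin n, 0 < u i → j < i →
      monomial (u - Finsupp.single i 1 + Finsupp.single j 1) (1 : K) ∈ I

end Ideals

/-- The set `ℤ_{>0} ∪ (ℤ_{>0})² ∪ ⋯ ∪ (ℤ_{>0})ⁿ` of tuples of positive integers of length between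
`1` and `n`; the first component of the dependent pair is the length minus one. -/
abbrev ExpTuple (n : ℕ) : Type := Σ s : Fin n, (Fin (s.1 + 1) → ℕ+)

/-- The length `t(a)` of `a = (a₁, …, a_t)`. -/
def ExpTuple.t {n : ℕ} (a : ExpTuple n) : ℕ := a.1.1 + 1

/-- The last entry `e(a) = a_t` of `a = (a₁, …, a_t)`. -/
def ExpTuple.e {n : ℕ} (a : ExpTuple n) : ℕ := a.2 (Fin.last a.1.1)

/-- The irreducible ideal `𝔪^a = (x₁^{a₁}, …, x_t^{a_t})` of `K[x₁, …, xₙ]`. -/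
noncomputable def irredIdeal (K : Type*) [Field K] {n : ℕ} (a : ExpTuple n) :
    Ideal (MvPolynomial (Fin n) K) :=
  Ideal.span (Set.range fun j : Fin (a.1.1 + 1) =>
    (X (Fin.castLE a.1.isLt j) : MvPolynomial (Fin n) K) ^ (a.2 j : ℕ))

/-- `I = ⋂_{a ∈ E} 𝔪^a`, and no proper subfamily of `E` has intersection `I`. -/
def IsIrredundantDecomposition {K : Type*} [Field K] {n : ℕ}
    (I : Ideal (MvPolynomial (Fin n) K)) (E : Finset (ExpTuple n)) : Prop :=
  (I = ⨅ a ∈ E, irredIdeal K a) ∧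
    ∀ F : Finset (ExpTuple n), F ⊂ E → I ≠ ⨅ a ∈ F, irredIdeal K a

section Degree

variable {K : Type*} [Field K] {n : ℕ}

/-- The Hilbert function `k ↦ dim_K (S/I)_k` of `S/I`, for a homogeneous ideal `I` of
`S = K[x₁, …, xₙ]`; the component `(S/I)_k` is the image of `S_k` in `S/I`. -/
noncomputable def hilbertFunction (I : Ideal (MvPolynomial (Fin n) K)) (k : ℕ) : ℕ :=
  Module.finrank K
    ((homogeneousSubmodule (Fin n) K k).map (Ideal.Quotient.mkₐ K I).toLinearMap)

/-- `P` is the Hilbert–Samuel polynomial of `S/I`, that is, `P(k) = ∑_{j ≤ k} dim_K (S/I)_j` for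
all large `k`. There is at most one such `P`, and for homogeneous `I` there is one, of degree
`dim S/I` if `I ≠ S`. -/
def IsHilbertSamuelPoly (I : Ideal (MvPolynomial (Fin n) K)) (P : Polynomial ℚ) : Prop :=
  ∀ᶠ k : ℕ in Filter.atTop,
    ((∑ j ∈ Finset.range (k + 1), hilbertFunction I j : ℕ) : ℚ) = P.eval (k : ℚ)

open Classical in
/-- The degree (multiplicity) `deg(S/I)` for a homogeneous ideal `I`: the number `e` such that
`∑_{j ≤ k} dim_K (S/I)_j = (e / d!) k^d + (lower order terms)` for large `k`, where `d` is the
degree of this polynomial. -/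
noncomputable def degree (I : Ideal (MvPolynomial (Fin n) K)) : ℚ :=
  if h : ∃ P, IsHilbertSamuelPoly I P then
    (Nat.factorial h.choose.natDegree : ℚ) * h.choose.leadingCoeff
  else 0

end Degree

section ArithmeticDegree

/-- The submodule `H⁰_J(M) = {m ∈ M | J^k m = 0 for some k}`. -/
def zerothLocalCohomology {R : Type*} [CommRing R] (J : Ideal R) (M : Type*) [AddCommGroup M]
    [Module R M] : Submodule R M :=
  ⨆ k : ℕ, Submodule.torsionBySet R M ((J ^ k : Ideal R) : Set R)

/-- The length multiplicity of a prime `p` of `R` with respect to `M`: the length of the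
`R_p`-module `H⁰_{p R_p}(M_p)`. It is finite if `R` is Noetherian and `M` is finitely generated. -/
noncomputable def lengthMult {R : Type*} [CommRing R] (p : Ideal R) [p.IsPrime] (M : Type*)
    [AddCommGroup M] [Module R M] : ℕ∞ :=
  Module.length (Localization.AtPrime p)
    (zerothLocalCohomology (IsLocalRing.maximalIdeal (Localization.AtPrime p))
      (LocalizedModule p.primeCompl M))

variable {K : Type*} [Field K] {n : ℕ}

/-- The contribution `mult_{S/I}(p) · deg(S/p)` of a prime `p` to the arithmetic degree of `S/I`. -/
noncomputable def adegTerm (I : Ideal (MvPolynomial (Fin n) K))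
    (p : PrimeSpectrum (MvPolynomial (Fin n) K)) : ℚ :=
  ((lengthMult p.asIdeal (MvPolynomial (Fin n) K ⧸ I)).toNat : ℚ) * degree p.asIdeal

/-- The arithmetic degree of `S/I`: the sum of `mult_{S/I}(p) · deg(S/p)` over the (finitely many)
associated primes `p` of `S/I`. -/
noncomputable def adeg (I : Ideal (MvPolynomial (Fin n) K)) : ℚ :=
  ∑ᶠ (p : PrimeSpectrum (MvPolynomial (Fin n) K))
    (_ : p.asIdeal ∈ associatedPrimes (MvPolynomial (Fin n) K) (MvPolynomial (Fin n) K ⧸ I)),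
    adegTerm I p

/-- The `i`-th arithmetic degree of `S/I`: the same sum, over the associated primes `p` with
`dim S/p = i` only. -/
noncomputable def adegAt (I : Ideal (MvPolynomial (Fin n) K)) (i : ℕ) : ℚ :=
  ∑ᶠ (p : PrimeSpectrum (MvPolynomial (Fin n) K))
    (_ : p.asIdeal ∈ associatedPrimes (MvPolynomial (Fin n) K) (MvPolynomial (Fin n) K ⧸ I) ∧
      ringKrullDim (MvPolynomial (Fin n) K ⧸ p.asIdeal) = (i : WithBot ℕ∞)),
    adegTerm I p

end ArithmeticDegree

end StronglyStable

/-!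
For any finite set `E` of tuples, the monomials outside `I = ⋂_{a ∈ E} 𝔪^a` are partitioned
into the families `{x^c x^w : w supported beyond x_s}`, one for each standard pair
`(x^c, {x_j : j > s})` of `I`. The number `ν_s` of standard pairs with index `s` is at the same time
the leading contribution of dimension `n - s` to the Hilbert–Samuel function of `S/I` and, because
multiplication by `x_1, …, x_s` only moves `c` up in the divisibility order, the length multiplicity
of `(x_1, …, x_s)`. So `adeg(S/I) = ∑_s ν_s`, and `deg(S/I) = ν_s` for the least length `s` in `E`.

If `I` is strongly stable and the decomposition irredundant, then `ν_s = ∑ e(a)` over the `a ∈ E` of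
length `s`: the standard pairs are the `(a_1 - 1, …, a_{s-1} - 1, k)` with `k < a_s`. Indeed, if `c`
lies below `a` but `c_j < a_j - 1` for some `j < s`, the exchange property trades a factor `x_j` for
`x_s`, which shows that `c` also lies below some `b ∈ E` with `b_s > a_s` or of length less than
`s`.
-/

namespace StronglyStable

open MvPolynomial

section Length

variable {R M : Type*} [CommRing R] [AddCommGroup M] [Module R M]

lemma length_eq_add_one_of_covBy {N N' : Submodule R M} (h : N ⋖ N') :
    Module.length R N' = Module.length R N + 1 := by
  have hsimple : IsSimpleModule R (N' ⧸ LinearMap.range (Submodule.inclusion h.le)) := by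
    rwa [Submodule.range_inclusion, ← covBy_iff_quot_is_simple h.le]
  rw [Module.length_eq_add_of_exact (Submodule.inclusion h.le) _
    (Submodule.inclusion_injective h.le) (Submodule.mkQ_surjective _)
    (LinearMap.exact_map_mkQ_range _), Module.length_eq_one_iff.2 hsimple]

variable [IsLocalRing R]

lemma covBy_span_singleton_sup_of_maximalIdeal_smul_mem {N : Submodule R M} {x : M} (hx : x ∉ N)
    (hsmul : ∀ r ∈ IsLocalRing.maximalIdeal R, r • x ∈ N) : N ⋖ Submodule.span R {x} ⊔ N := by
  refine ⟨le_sup_right.lt_of_ne fun h => hx ?_, fun L hNL hL => hL.not_ge (sup_le ?_ hNL.le)⟩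
  · rw [h]
    exact Submodule.mem_sup_left (Submodule.mem_span_singleton_self x)
  · obtain ⟨y, hyL, hyN⟩ := SetLike.exists_of_lt hNL
    obtain ⟨_, hrx, z, hz, rfl⟩ := Submodule.mem_sup.1 (hL.le hyL)
    obtain ⟨r, rfl⟩ := Submodule.mem_span_singleton.1 hrx
    have hr : IsUnit r := IsLocalRing.notMem_maximalIdeal.1 fun h => hyN (add_mem (hsmul r h) hz)
    rw [Submodule.span_singleton_le_iff_mem, ← Submodule.smul_mem_iff_of_isUnit L hr]
    exact (Submodule.add_mem_iff_left L (hNL.le hz)).1 hyL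

lemma length_span_image_eq_card {ι : Type*} [PartialOrder ι] (x : ι → M) (s : Finset ι)
    (hsmul : ∀ i ∈ s, ∀ r ∈ IsLocalRing.maximalIdeal R,
      r • x i ∈ Submodule.span R (x '' {j | j ∈ s ∧ i < j}))
    (hindep : ∀ i ∈ s, x i ∉ Submodule.span R (x '' {j | j ∈ s ∧ ¬ j ≤ i})) :
    Module.length R (Submodule.span R (x '' s)) = s.card := by
  classical
  induction s using Finset.strongInduction with
  | H s ih =>
    rcases s.eq_empty_or_nonempty with rfl | hs
    · rw [Finset.coe_empty, Set.image_empty, Submodule.span_empty, Module.length_bot,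
        Finset.card_empty, Nat.cast_zero]
    obtain ⟨i, hi⟩ := s.exists_minimal hs
    have hspan : Submodule.span R (x '' s) =
        Submodule.span R {x i} ⊔ Submodule.span R (x '' (s.erase i)) := by
      rw [← Submodule.span_insert, ← Set.image_insert_eq, ← Finset.coe_insert,
        Finset.insert_erase hi.prop]
    have herase : Module.length R (Submodule.span R (x '' (s.erase i))) = (s.erase i).card := by
      refine ih _ (Finset.erase_ssubset hi.prop) (fun k hk r hr => ?_) fun k hk hspan => ?_
      · refine Submodule.span_mono (Set.image_mono ?_) (hsmul k (Finset.mem_of_mem_erase hk) r hr)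
        rintro j ⟨hj, hkj⟩
        refine ⟨Finset.mem_erase.2 ⟨?_, hj⟩, hkj⟩
        rintro rfl
        exact hi.not_lt (Finset.mem_of_mem_erase hk) hkj
      · refine hindep k (Finset.mem_of_mem_erase hk)
          (Submodule.span_mono (Set.image_mono ?_) hspan)
        exact fun j hj => ⟨Finset.mem_of_mem_erase hj.1, hj.2⟩
    rw [hspan, length_eq_add_one_of_covBy (covBy_span_singleton_sup_of_maximalIdeal_smul_mem ?_ ?_),
      herase, ← Nat.cast_add_one, Finset.card_erase_add_one hi.prop]
    · refine fun h => hindep i hi.prop (Submodule.span_mono (Set.image_mono ?_) h)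
      exact fun j hj => ⟨Finset.mem_of_mem_erase hj,
        fun hji => Finset.ne_of_mem_erase hj (hi.eq_of_le (Finset.mem_of_mem_erase hj) hji)⟩
    · refine fun r hr => Submodule.span_mono (Set.image_mono ?_) (hsmul i hi.prop r hr)
      exact fun j hj => Finset.mem_erase.2 ⟨hj.2.ne', hj.1⟩

end Length

section LengthMult

variable {R M : Type*} [CommRing R] [AddCommGroup M] [Module R M]

lemma mem_zerothLocalCohomology_iff {J : Ideal R} {m : M} :
    m ∈ zerothLocalCohomology J M ↔ ∃ k : ℕ, m ∈ Submodule.torsionBySet R M (J ^ k : Ideal R) :=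
  Submodule.mem_iSup_of_directed _ <| Monotone.directed_le fun _ _ hkl =>
    Submodule.torsionBySet_le_torsionBySet_of_subset (Ideal.pow_le_pow_right hkl)

variable {p : Ideal R} [p.IsPrime]

lemma mkLinearMap_mem_span_image_iff {T : Set M} {m : M} :
    LocalizedModule.mkLinearMap p.primeCompl M m ∈ Submodule.span (Localization.AtPrime p)
      (LocalizedModule.mkLinearMap p.primeCompl M '' T) ↔
    ∃ r ∉ p, r • m ∈ Submodule.span R T := by
  set loc := LocalizedModule.mkLinearMap p.primeCompl M
  rw [← Submodule.localized'_span (Localization.AtPrime p) p.primeCompl loc,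
    Submodule.mem_localized']
  constructor
  · rintro ⟨g, hg, s, hs⟩
    rw [IsLocalizedModule.mk'_eq_iff, Submonoid.smul_def, ← map_smul,
      IsLocalizedModule.eq_iff_exists p.primeCompl] at hs
    obtain ⟨s', hs'⟩ := hs
    refine ⟨s' * s, (s' * s).2, ?_⟩
    rw [mul_smul]
    exact hs' ▸ Submodule.smul_mem _ (s' : R) hg
  · rintro ⟨r, hr, hm⟩
    exact ⟨r • m, hm, ⟨r, hr⟩, (IsLocalizedModule.mk'_eq_iff).2 (map_smul loc r m)⟩

lemma mkLinearMap_mem_zerothLocalCohomology_iff {m : M} :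
    LocalizedModule.mkLinearMap p.primeCompl M m ∈ zerothLocalCohomology
      (IsLocalRing.maximalIdeal (Localization.AtPrime p)) (LocalizedModule p.primeCompl M) ↔
    ∃ k : ℕ, ∀ r ∈ p ^ k, ∃ t ∉ p, t • r • m = 0 := by
  simp_rw [mem_zerothLocalCohomology_iff, ← Localization.AtPrime.map_eq_maximalIdeal,
    ← Ideal.map_pow, Ideal.map, ← Submodule.torsionBySet_eq_torsionBySet_span,
    Submodule.mem_torsionBySet_iff]
  refine exists_congr fun k => ?_
  simp only [Subtype.forall, Set.forall_mem_image, SetLike.mem_coe, algebraMap_smul, ← map_smul,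
    IsLocalizedModule.eq_zero_iff p.primeCompl, Subtype.exists, exists_prop, Submonoid.mk_smul,
    Ideal.mem_primeCompl_iff]

lemma smul_mem_of_mem_maximalIdeal {T : Set R} (hT : p = Ideal.span T)
    {N : Submodule (Localization.AtPrime p) (LocalizedModule p.primeCompl M)}
    {y : LocalizedModule p.primeCompl M} (h : ∀ t ∈ T, t • y ∈ N) :
    ∀ r ∈ IsLocalRing.maximalIdeal (Localization.AtPrime p), r • y ∈ N := by
  suffices hle : IsLocalRing.maximalIdeal (Localization.AtPrime p) ≤
      N.comap (LinearMap.toSpanSingleton _ _ y) from hle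
  rw [← Localization.AtPrime.map_eq_maximalIdeal,
    (congrArg (Ideal.map _) hT).trans (Ideal.map_span _ T), Ideal.span_le]
  rintro _ ⟨t, ht, rfl⟩
  simpa using h t ht

theorem lengthMult_eq_card {T : Set R} (hT : p = Ideal.span T) {ι : Type*} [PartialOrder ι]
    (x : ι → M) (s : Finset ι)
    (hgen : ∀ m : M, (∃ k : ℕ, ∀ r ∈ p ^ k, ∃ t ∉ p, t • r • m = 0) ↔
      ∃ r ∉ p, r • m ∈ Submodule.span R (x '' s))
    (hsmul : ∀ i ∈ s, ∀ t ∈ T, ∃ r ∉ p, r • t • x i ∈ Submodule.span R (x '' {j | j ∈ s ∧ i < j}))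
    (hindep : ∀ i ∈ s, ∀ r ∉ p, r • x i ∉ Submodule.span R (x '' {j | j ∈ s ∧ ¬ j ≤ i})) :
    lengthMult p M = s.card := by
  set loc := LocalizedModule.mkLinearMap p.primeCompl M
  have hspan : zerothLocalCohomology (IsLocalRing.maximalIdeal (Localization.AtPrime p))
      (LocalizedModule p.primeCompl M) =
        Submodule.span (Localization.AtPrime p) ((loc ∘ x) '' s) := by
    refine (Submodule.localized'gi (Localization.AtPrime p) p.primeCompl loc).u_injective ?_
    ext m
    rw [Set.image_comp]
    exact mkLinearMap_mem_zerothLocalCohomology_iff.trans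
      ((hgen m).trans mkLinearMap_mem_span_image_iff.symm)
  rw [lengthMult, hspan]
  refine length_span_image_eq_card _ s (fun i hi => smul_mem_of_mem_maximalIdeal hT fun t ht => ?_)
    fun i hi h => ?_
  · rw [Function.comp_apply, ← map_smul, Set.image_comp]
    exact mkLinearMap_mem_span_image_iff.2 (hsmul i hi t ht)
  · rw [Function.comp_apply, Set.image_comp] at h
    obtain ⟨r, hr, hri⟩ := mkLinearMap_mem_span_image_iff.1 h
    exact hindep i hi r hr hri

end LengthMult

section ExpTuple

lemma filter_le_self {σ : Type*} (p : σ → Prop) [DecidablePred p] (u : σ →₀ ℕ) :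
    u.filter p ≤ u := fun i => by
  rw [Finsupp.filter_apply]
  split_ifs <;> simp

variable {n : ℕ}

/-- The exponent vector `(a₁ - 1, …, a_t - 1, 0, …, 0)` of the monomial whose class generates the
socle of `K[x₁, …, x_t] / 𝔪^a`. -/
noncomputable def ExpTuple.socleExp (a : ExpTuple n) : Fin n →₀ ℕ :=
  Finsupp.equivFunOnFinite.symm fun j =>
    if h : j ≤ a.1 then (a.2 ⟨j.1, Nat.lt_succ_of_le h⟩ : ℕ) - 1 else 0

/-- The exponent vectors of the monomials outside `𝔪^a`. -/
def ExpTuple.box (a : ExpTuple n) : Set (Fin n →₀ ℕ) :=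
  {u | ∀ j ≤ a.1, u j ≤ a.socleExp j}

namespace ExpTuple

variable {a b : ExpTuple n} {u v : Fin n →₀ ℕ}

lemma socleExp_castLE (a : ExpTuple n) (j : Fin (a.1.1 + 1)) :
    a.socleExp (Fin.castLE a.1.isLt j) = a.2 j - 1 := by
  have hj : Fin.castLE a.1.isLt j ≤ a.1 := Nat.le_of_lt_succ j.2
  simp [socleExp, hj]

lemma e_eq_socleExp_add_one (a : ExpTuple n) : a.e = a.socleExp a.1 + 1 := by
  have h : a.1 = Fin.castLE a.1.isLt (Fin.last a.1.1) := by simp [Fin.last]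
  conv_rhs => rw [h, socleExp_castLE, Nat.sub_add_cancel (a.2 _).pos]
  rfl

lemma socleExp_of_gt (a : ExpTuple n) {j : Fin n} (hj : a.1 < j) : a.socleExp j = 0 := by
  simp [socleExp, hj.not_ge]

lemma mem_box_of_le (h : u ≤ v) (hv : v ∈ a.box) : u ∈ a.box :=
  fun j hj => (h j).trans (hv j hj)

lemma mem_box_congr (h : ∀ j ≤ a.1, u j = v j) : u ∈ a.box ↔ v ∈ a.box :=
  forall₂_congr fun j hj => by rw [h j hj]

lemma socleExp_mem_box (a : ExpTuple n) : a.socleExp ∈ a.box := fun _ _ => le_rfl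

lemma box_subset_box (h : b.1 ≤ a.1) (hle : ∀ j ≤ b.1, a.socleExp j ≤ b.socleExp j) :
    a.box ⊆ b.box :=
  fun _ hu j hj => (hu j (hj.trans h)).trans (hle j hj)

lemma filter_le_socleExp_iff : u.filter (· ≤ a.1) ≤ a.socleExp ↔ u ∈ a.box := by
  refine forall_congr' fun j => ?_
  by_cases hj : j ≤ a.1
  · simp [hj]
  · simp [hj]

end ExpTuple

/-- The exponent vectors `c` supported in the variables up to `x_s` such that `(x^c, {x_j : j > s})`
is a standard pair (in the sense of Sturmfels, Trung and Vogel) of the intersection of the ideals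
`𝔪^a`, `a ∈ E`: the monomials `x^c x^w` with `w` supported beyond `s` avoid this intersection, and
`c` lies in no box of a shorter tuple. -/
noncomputable def standardExps (E : Finset (ExpTuple n)) (s : Fin n) : Finset (Fin n →₀ ℕ) :=
  open Classical in
  {c ∈ {a ∈ E | a.1 = s}.biUnion fun a => Finset.Iic a.socleExp | ∀ b ∈ E, b.1 < s → c ∉ b.box}

variable {E : Finset (ExpTuple n)} {s : Fin n} {c u : Fin n →₀ ℕ}

lemma mem_standardExps : c ∈ standardExps E s ↔
    (∃ a ∈ E, a.1 = s ∧ c ≤ a.socleExp) ∧ ∀ b ∈ E, b.1 < s → c ∉ b.box := by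
  classical simp [standardExps, and_assoc]

lemma filter_mem_standardExps_iff : u.filter (· ≤ s) ∈ standardExps E s ↔
    (∃ a ∈ E, a.1 = s ∧ u ∈ a.box) ∧ ∀ b ∈ E, b.1 < s → u ∉ b.box := by
  rw [mem_standardExps]
  refine and_congr (exists_congr fun a => and_congr_right fun _ => and_congr_right ?_)
    (forall₂_congr fun b _ => forall_congr' fun hb => not_congr ?_)
  · rintro rfl
    exact ExpTuple.filter_le_socleExp_iff
  · exact ExpTuple.mem_box_congr fun j hj => Finsupp.filter_apply_pos _ _ (hj.trans hb.le)

lemma filter_eq_of_mem_standardExps (hc : c ∈ standardExps E s) : c.filter (· ≤ s) = c := by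
  obtain ⟨⟨a, -, rfl, hca⟩, -⟩ := mem_standardExps.1 hc
  refine Finsupp.filter_eq_self_iff _ _ |>.2 fun j hj => ?_
  by_contra h
  exact hj (Nat.le_zero.1 ((hca j).trans_eq (a.socleExp_of_gt (not_le.1 h))))

lemma apply_eq_zero_of_mem_standardExps (hc : c ∈ standardExps E s) {j : Fin n} (hj : s < j) :
    c j = 0 := by
  rw [← filter_eq_of_mem_standardExps hc, Finsupp.filter_apply_neg (· ≤ s) _ hj.not_ge]

lemma mem_standardExps_of_le (hc : c ∈ standardExps E s) (hcu : c ≤ u) (hu : u.filter (· ≤ s) = u)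
    (hE : ∃ b ∈ E, b.1 ≤ s ∧ u ∈ b.box) : u ∈ standardExps E s := by
  have hlt : ∀ b ∈ E, b.1 < s → u ∉ b.box := fun b hb hbs hub =>
    (mem_standardExps.1 hc).2 b hb hbs (ExpTuple.mem_box_of_le hcu hub)
  obtain ⟨b, hb, hbs, hub⟩ := hE
  rw [← hu, filter_mem_standardExps_iff]
  exact ⟨⟨b, hb, hbs.eq_of_not_lt fun h => hlt b hb h hub, hub⟩, hlt⟩

lemma exists_filter_mem_standardExps_iff :
    (∃ s, u.filter (· ≤ s) ∈ standardExps E s) ↔ ∃ a ∈ E, u ∈ a.box := by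
  simp_rw [filter_mem_standardExps_iff]
  constructor
  · rintro ⟨s, ⟨a, ha, -, hu⟩, -⟩
    exact ⟨a, ha, hu⟩
  · rintro ⟨a, ha, hu⟩
    obtain ⟨b, ⟨hb, hub⟩, hmin⟩ := Set.exists_min_image {a | a ∈ E ∧ u ∈ a.box} Sigma.fst
      (E.finite_toSet.subset fun _ h => h.1) ⟨a, ha, hu⟩
    exact ⟨b.1, ⟨b, hb, rfl, hub⟩, fun c hc hcb huc => hcb.not_ge (hmin c ⟨hc, huc⟩)⟩

lemma eq_of_filter_mem_standardExps {s s' : Fin n} (h : u.filter (· ≤ s) ∈ standardExps E s)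
    (h' : u.filter (· ≤ s') ∈ standardExps E s') : s = s' := by
  rw [filter_mem_standardExps_iff] at h h'
  obtain ⟨⟨⟨a, ha, rfl, hua⟩, hlt⟩, ⟨b, hb, rfl, hub⟩, hlt'⟩ := And.intro h h'
  exact le_antisymm (not_lt.1 fun hba => hlt b hb hba hub) (not_lt.1 fun hab => hlt' a ha hab hua)

end ExpTuple

section Monomials

lemma mem_sup_span_monomial_image_iff {σ R : Type*} [CommRing R] {I : Ideal (MvPolynomial σ R)}
    (hI : ∀ f ∈ I, ∀ u ∈ f.support, monomial u 1 ∈ I) {C : Set (σ →₀ ℕ)} {f : MvPolynomial σ R} :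
    f ∈ I ⊔ Ideal.span ((monomial · 1) '' C) ↔
      ∀ u ∈ f.support, monomial u 1 ∈ I ∨ ∃ c ∈ C, c ≤ u := by
  have hspan : I = Ideal.span ((monomial · 1) '' {u | monomial u 1 ∈ I}) := by
    refine le_antisymm (fun f hf => ?_) (Ideal.span_le.2 (Set.image_subset_iff.2 fun _ => id))
    exact mem_ideal_span_monomial_image.2 fun u hu => ⟨u, hI f hf u hu, le_rfl⟩
  have hmono (u : σ →₀ ℕ) : (∃ v, monomial v 1 ∈ I ∧ v ≤ u) ↔ monomial u 1 ∈ I :=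
    ⟨fun ⟨v, hv, hvu⟩ => I.mem_of_dvd (monomial_dvd_monomial.2 ⟨Or.inr hvu, one_dvd _⟩) hv,
      fun hu => ⟨u, hu, le_rfl⟩⟩
  conv_lhs => rw [hspan, ← Ideal.span_union, ← Set.image_union, mem_ideal_span_monomial_image]
  simp only [Set.mem_union, or_and_right, exists_or, Set.mem_ofPred_eq, hmono]

variable {K : Type*} [Field K] {n : ℕ} {a : ExpTuple n} {E : Finset (ExpTuple n)}
  {f : MvPolynomial (Fin n) K} {u : Fin n →₀ ℕ}

lemma mem_irredIdeal_iff : f ∈ irredIdeal K a ↔ ∀ u ∈ f.support, u ∉ a.box := by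
  have hspan : irredIdeal K a = Ideal.span ((fun u => monomial u (1 : K)) ''
      (Set.range fun j : Fin (a.1.1 + 1) =>
        Finsupp.single (Fin.castLE a.1.isLt j) (a.2 j : ℕ))) := by
    simp only [irredIdeal, ← Set.range_comp, Function.comp_def, X_pow_eq_monomial]
  rw [hspan, mem_ideal_span_monomial_image]
  refine forall₂_congr fun u _ => ?_
  simp only [Set.exists_range_iff, Finsupp.single_le_iff, ExpTuple.box, Set.mem_ofPred_eq,
    not_forall, not_le]
  constructor
  · rintro ⟨j, hj⟩
    refine ⟨Fin.castLE a.1.isLt j, Nat.le_of_lt_succ j.2, ?_⟩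
    rw [a.socleExp_castLE]
    exact (Nat.sub_lt (a.2 j).pos one_pos).trans_le hj
  · rintro ⟨j, hj, hlt⟩
    refine ⟨⟨j.1, Nat.lt_succ_of_le hj⟩, ?_⟩
    have := a.socleExp_castLE ⟨j.1, Nat.lt_succ_of_le hj⟩
    exact Nat.le_of_pred_lt (this.symm.trans_lt hlt)

variable (K) in
/-- The intersection `⋂_{a ∈ E} 𝔪^a`. -/
noncomputable def irredInter (E : Finset (ExpTuple n)) : Ideal (MvPolynomial (Fin n) K) :=
  ⨅ a ∈ E, irredIdeal K a

lemma irredInter_le (ha : a ∈ E) : irredInter K E ≤ irredIdeal K a := biInf_le _ ha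

lemma mem_irredInter_iff : f ∈ irredInter K E ↔ ∀ u ∈ f.support, ∀ a ∈ E, u ∉ a.box := by
  simp only [irredInter, Ideal.mem_iInf, mem_irredIdeal_iff]
  exact ⟨fun h u hu a ha => h a ha u hu, fun h a ha u hu => h u hu a ha⟩

lemma monomial_mem_irredIdeal_iff : monomial u 1 ∈ irredIdeal K a ↔ u ∉ a.box := by
  classical simp [mem_irredIdeal_iff, support_monomial]

lemma monomial_mem_irredInter_iff {r : K} (hr : r ≠ 0) :
    monomial u r ∈ irredInter K E ↔ ∀ a ∈ E, u ∉ a.box := by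
  classical simp [mem_irredInter_iff, support_monomial, hr]

end Monomials

section VariableIdeals

variable {σ R : Type*} [CommRing R]

lemma X_mem_span_X_image_iff [Nontrivial R] {s : Set σ} {i : σ} :
    (X i : MvPolynomial σ R) ∈ Ideal.span (X '' s) ↔ i ∈ s := by
  classical
  simp [mem_ideal_span_X_image, support_X, Finsupp.single_apply]

lemma sub_rename_killCompl_mem_span_X_image (s : Set σ) (f : MvPolynomial σ R) :
    f - rename (↑) (killCompl (Subtype.val_injective (p := (· ∉ s))) f) ∈ Ideal.span (X '' s) := by
  rw [← Ideal.Quotient.mk_eq_mk_iff_sub_mem]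
  let π := Ideal.Quotient.mkₐ R (Ideal.span (X '' s : Set (MvPolynomial σ R)))
  suffices h : π = π.comp ((rename (↑)).comp (killCompl (Subtype.val_injective (p := (· ∉ s)))))
    from DFunLike.congr_fun h f
  ext i
  by_cases hi : i ∈ s
  · simpa [π, killCompl, hi, Ideal.Quotient.eq_zero_iff_mem] using
      Ideal.subset_span (Set.mem_image_of_mem X hi)
  · have hX : (X i : MvPolynomial σ R) = rename Subtype.val (X (⟨i, hi⟩ : {i // i ∉ s})) := by
      rw [rename_X]
    rw [AlgHom.comp_apply, AlgHom.comp_apply, hX, killCompl_rename_app]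

lemma ker_killCompl_val (s : Set σ) :
    RingHom.ker (killCompl (R := R) (Subtype.val_injective (p := (· ∉ s)))) =
      Ideal.span (X '' s) := by
  refine le_antisymm (fun f hf => ?_) (Ideal.span_le.2 ?_)
  · have := sub_rename_killCompl_mem_span_X_image s f
    rwa [RingHom.mem_ker.1 hf, map_zero, sub_zero] at this
  · rintro _ ⟨i, hi, rfl⟩
    simp [killCompl, hi]

lemma isPrime_span_X_image [IsDomain R] (s : Set σ) :
    (Ideal.span (X '' s) : Ideal (MvPolynomial σ R)).IsPrime :=
  ker_killCompl_val (R := R) s ▸ RingHom.ker_isPrime _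

lemma ringKrullDim_quotient_span_X_image [IsNoetherianRing R] [Finite σ] (s : Set σ) :
    ringKrullDim (MvPolynomial σ R ⧸ Ideal.span (X '' s : Set (MvPolynomial σ R))) =
      ringKrullDim R + sᶜ.ncard := by
  have hsurj : Function.Surjective (killCompl (R := R) (Subtype.val_injective (p := (· ∉ s)))) :=
    fun f => ⟨_, killCompl_rename_app _ f⟩
  have e := (Ideal.quotientEquivAlgOfEq R (ker_killCompl_val (R := R) s)).symm.trans
    (Ideal.quotientKerAlgEquivOfSurjective hsurj)
  rw [ringKrullDim_eq_of_ringEquiv e.toRingEquiv, MvPolynomial.ringKrullDim_of_isNoetherianRing,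
    ← Nat.card_coe_set_eq, Set.coe_eq_subtype]
  simp only [Set.mem_compl_iff]

lemma height_span_X_image [IsDomain R] [IsNoetherianRing R] [Finite σ] (s : Finset σ) :
    (Ideal.span (X '' s) : Ideal (MvPolynomial σ R)).height = s.card := by
  classical
  have hprime (t : Finset σ) := isPrime_span_X_image (R := R) (t : Set σ)
  refine le_antisymm ?_ ?_
  · refine (Ideal.height_le_card_of_mem_minimalPrimes_span_finset (s := s.image X) ?_).trans
      (Nat.cast_le.2 Finset.card_image_le)
    rw [Finset.coe_image, Ideal.minimalPrimes_eq_subsingleton_self]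
    rfl
  · induction s using Finset.induction with
    | empty => simp
    | insert i s hi ih =>
      have hlt : (Ideal.span (X '' s) : Ideal (MvPolynomial σ R)) <
          Ideal.span (X '' (insert i s : Finset σ)) := by
        refine (Ideal.span_mono (Set.image_mono (by simp))).lt_of_not_ge fun hle => hi ?_
        exact X_mem_span_X_image_iff.1 (hle (X_mem_span_X_image_iff.2 (by simp)))
      rw [Finset.card_insert_of_notMem hi, Nat.cast_add_one]
      exact (add_le_add_left ih 1).trans (Ideal.height_add_one_le_of_lt_of_isPrime hlt)

end VariableIdeals

section VarIdeal

variable (K : Type*) [Field K] {n : ℕ}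

/-- The ideal `(x_j : j ≤ s)`, generated by the first `s + 1` variables since the index `s` is
counted from zero. -/
noncomputable def varIdeal (s : Fin n) : Ideal (MvPolynomial (Fin n) K) :=
  Ideal.span (X '' Set.Iic s)

instance (s : Fin n) : (varIdeal K s).IsPrime := isPrime_span_X_image _

lemma ringKrullDim_quotient_varIdeal (s : Fin n) :
    ringKrullDim (MvPolynomial (Fin n) K ⧸ varIdeal K s) = (n - (s + 1) : ℕ) := by
  rw [varIdeal, ringKrullDim_quotient_span_X_image, ringKrullDim_eq_zero_of_field, zero_add,
    Set.compl_Iic, ← Finset.coe_Ioi, Set.ncard_coe_finset, Fin.card_Ioi, Nat.sub_sub, add_comm 1]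

lemma height_varIdeal (s : Fin n) : (varIdeal K s).height = s + 1 := by
  rw [varIdeal, ← Finset.coe_Iic, height_span_X_image, Fin.card_Iic, Nat.cast_add_one]

variable {K} {s s' : Fin n} {f : MvPolynomial (Fin n) K}

lemma mem_varIdeal_iff : f ∈ varIdeal K s ↔ ∀ u ∈ f.support, ∃ j ≤ s, u j ≠ 0 :=
  mem_ideal_span_X_image

lemma X_mem_varIdeal_iff {j : Fin n} : (X j : MvPolynomial (Fin n) K) ∈ varIdeal K s ↔ j ≤ s :=
  X_mem_span_X_image_iff

lemma varIdeal_le_varIdeal_iff : varIdeal K s ≤ varIdeal K s' ↔ s ≤ s' :=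
  ⟨fun h => X_mem_varIdeal_iff.1 (h (X_mem_varIdeal_iff.2 le_rfl)),
    fun h => Ideal.span_mono (Set.image_mono (Set.Iic_subset_Iic.2 h))⟩

lemma varIdeal_injective : Function.Injective (varIdeal K : Fin n → _) := fun _ _ h =>
  le_antisymm (varIdeal_le_varIdeal_iff.1 h.le) (varIdeal_le_varIdeal_iff.1 h.ge)

end VarIdeal

section Primary

variable {K : Type*} [Field K] {n : ℕ} {a : ExpTuple n} {f g : MvPolynomial (Fin n) K}
  {w : Fin n →₀ ℕ}

lemma support_monomial_one_mul (w : Fin n →₀ ℕ) (f : MvPolynomial (Fin n) K) :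
    (monomial w 1 * f).support = f.support.map (addLeftEmbedding w) :=
  AddMonoidAlgebra.support_coeff_single_mul f (1 : K) (by simp) w

lemma monomial_mul_mem_irredIdeal_iff :
    monomial w 1 * f ∈ irredIdeal K a ↔ ∀ u ∈ f.support, w + u ∉ a.box := by
  simp [mem_irredIdeal_iff, support_monomial_one_mul]

lemma monomial_socleExp_mul_mem_irredIdeal_iff :
    monomial a.socleExp 1 * f ∈ irredIdeal K a ↔ f ∈ varIdeal K a.1 := by
  rw [monomial_mul_mem_irredIdeal_iff, mem_varIdeal_iff]
  refine forall₂_congr fun u _ => ?_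
  simp [ExpTuple.box]

lemma mem_irredIdeal_sup_span_socle (h : ∀ u ∈ f.support, u ∈ a.box → a.socleExp ≤ u) :
    f ∈ irredIdeal K a ⊔ Ideal.span {monomial a.socleExp 1} := by
  have hI : ∀ g ∈ irredIdeal K a, ∀ u ∈ g.support, monomial u 1 ∈ irredIdeal K a :=
    fun g hg u hu => monomial_mem_irredIdeal_iff.2 (mem_irredIdeal_iff.1 hg u hu)
  rw [← Set.image_singleton (f := (monomial · (1 : K))), mem_sup_span_monomial_image_iff hI]
  simpa only [monomial_mem_irredIdeal_iff, Set.mem_singleton_iff, exists_eq_left,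
    ← imp_iff_not_or] using h

lemma exists_monomial_mul_sub_mem_irredIdeal (hg : g ∉ irredIdeal K a) :
    ∃ w, ∃ q ∉ varIdeal K a.1, monomial w 1 * g - monomial a.socleExp 1 * q ∈ irredIdeal K a := by
  obtain ⟨u, ⟨hu, hua⟩, hmin⟩ : ∃ u, MinimalFor (fun v => v ∈ g.support ∧ v ∈ a.box)
      (fun v => v.filter (· ≤ a.1)) u := by
    obtain ⟨u, hu, hua⟩ : ∃ u ∈ g.support, u ∈ a.box := by simpa [mem_irredIdeal_iff] using hg
    exact exists_minimalFor_of_wellFoundedLT _ _ ⟨u, hu, hua⟩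
  set w := a.socleExp - u.filter (· ≤ a.1)
  have hw : w + u.filter (· ≤ a.1) = a.socleExp :=
    tsub_add_cancel_of_le (ExpTuple.filter_le_socleExp_iff.2 hua)
  have hwu : w + u ∈ a.box := fun j hj => by simp [← hw, hj]
  have hle (v) (hv : v ∈ g.support) (hwv : w + v ∈ a.box) : a.socleExp ≤ w + v := by
    have hvu : v.filter (· ≤ a.1) ≤ u.filter (· ≤ a.1) := fun j => by
      by_cases hj : j ≤ a.1
      · simpa [← hw, hj] using hwv j hj
      · simp [hj]
    have huv : u.filter (· ≤ a.1) ≤ v.filter (· ≤ a.1) :=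
      hmin ⟨hv, ExpTuple.mem_box_of_le le_add_self hwv⟩ hvu
    rw [← hw]
    exact add_le_add_right (huv.trans (filter_le_self _ _)) w
  obtain ⟨r, hr, _, hq, hrq⟩ := Submodule.mem_sup.1 <|
    mem_irredIdeal_sup_span_socle (f := monomial w 1 * g) (a := a) <| by
      simpa [support_monomial_one_mul] using hle
  obtain ⟨q, rfl⟩ := Ideal.mem_span_singleton.1 hq
  refine ⟨w, q, fun hqP => ?_, by rwa [← hrq, add_sub_cancel_right]⟩
  have hwg := add_mem hr (monomial_socleExp_mul_mem_irredIdeal_iff.2 hqP)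
  exact monomial_mul_mem_irredIdeal_iff.1 (hrq ▸ hwg) u hu hwu

lemma mem_varIdeal_of_mul_mem_irredIdeal (h : f * g ∈ irredIdeal K a) (hg : g ∉ irredIdeal K a) :
    f ∈ varIdeal K a.1 := by
  obtain ⟨w, q, hq, hwq⟩ := exists_monomial_mul_sub_mem_irredIdeal hg
  refine (Ideal.IsPrime.mem_or_mem inferInstance ?_).resolve_right hq
  rw [← monomial_socleExp_mul_mem_irredIdeal_iff]
  have hfw : f * (monomial w 1 * g) ∈ irredIdeal K a := by
    rw [mul_left_comm]
    exact Ideal.mul_mem_left _ _ h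
  have := sub_mem hfw (Ideal.mul_mem_left _ f hwq)
  rwa [← mul_sub, sub_sub_cancel, mul_left_comm] at this

lemma radical_irredIdeal (a : ExpTuple n) : (irredIdeal K a).radical = varIdeal K a.1 := by
  refine le_antisymm (Ideal.IsPrime.radical_le_iff inferInstance |>.2 ?_) ?_
  · refine Ideal.span_le.2 ?_
    rintro _ ⟨j, rfl⟩
    exact Ideal.pow_mem_of_mem _ (X_mem_varIdeal_iff.2 (Nat.le_of_lt_succ j.2)) _ (a.2 j).pos
  · refine Ideal.span_le.2 ?_
    rintro _ ⟨j, hj, rfl⟩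
    exact ⟨_, Ideal.subset_span ⟨⟨j.1, Nat.lt_succ_of_le hj⟩, rfl⟩⟩

end Primary

section Tail

variable {n : ℕ}

lemma ExpTuple.notMem_box_of_e_le {b : ExpTuple n} {u : Fin n →₀ ℕ} (h : b.e ≤ u b.1) :
    u ∉ b.box := fun hu => by
  have := hu b.1 le_rfl
  rw [b.e_eq_socleExp_add_one] at h
  omega

lemma exists_forall_add_notMem_box (E : Finset (ExpTuple n)) (s : Fin n) :
    ∃ w : Fin n →₀ ℕ, (∀ j ≤ s, w j = 0) ∧ ∀ b ∈ E, s < b.1 → ∀ u, w + u ∉ b.box := by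
  refine ⟨∑ b ∈ E with s < b.1, Finsupp.single b.1 b.e, fun j hj => ?_, fun b hb hsb u => ?_⟩
  · rw [Finsupp.finsetSum_apply]
    refine Finset.sum_eq_zero fun b hb => Finsupp.single_eq_of_ne ?_
    exact (hj.trans_lt (Finset.mem_filter.1 hb).2).ne
  · refine ExpTuple.notMem_box_of_e_le ?_
    calc b.e = Finsupp.single b.1 b.e b.1 := by simp
      _ ≤ (∑ b ∈ E with s < b.1, Finsupp.single b.1 b.e) b.1 :=
        Finset.single_le_sum (f := fun b : ExpTuple n => Finsupp.single b.1 b.e)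
          (fun _ _ => zero_le) (Finset.mem_filter.2 ⟨hb, hsb⟩) b.1
      _ ≤ _ := by simp

end Tail

section AssociatedPrimes

lemma isAssociatedPrime_quotient_iff {R : Type*} [CommRing R] [IsNoetherianRing R]
    {I p : Ideal R} :
    IsAssociatedPrime p (R ⧸ I) ↔ p.IsPrime ∧ ∃ g, p = I.colon {g} := by
  rw [isAssociatedPrime_iff, Ideal.Quotient.mk_surjective.exists]
  simp only [SetLike.ext_iff (p := p), Submodule.mem_colon_singleton, Submodule.mem_bot]
  refine and_congr_right fun _ => exists_congr fun g => forall_congr' fun r => ?_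
  rw [smul_eq_mul, ← Ideal.Quotient.eq_zero_iff_mem (I := I), map_mul]
  rfl

variable {K : Type*} [Field K] {n : ℕ} {E : Finset (ExpTuple n)} {s : Fin n}

lemma colon_irredInter_of_maximal {c w : Fin n →₀ ℕ} (hc : Maximal (· ∈ standardExps E s) c)
    (hw : ∀ j ≤ s, w j = 0) (hwE : ∀ b ∈ E, s < b.1 → ∀ u, w + u ∉ b.box) :
    (irredInter K E).colon {monomial (w + c) 1} = varIdeal K s := by
  obtain ⟨⟨a, ha, rfl, hca⟩, -⟩ := mem_standardExps.1 hc.prop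
  have hwc {b : ExpTuple n} (hb : b.1 ≤ a.1) (u : Fin n →₀ ℕ) : w + u ∈ b.box ↔ u ∈ b.box :=
    ExpTuple.mem_box_congr fun j hj => by simp [hw j (hj.trans hb)]
  refine le_antisymm (fun f hf => ?_) (Ideal.span_le.2 ?_)
  · rw [Submodule.mem_colon_singleton, smul_eq_mul] at hf
    refine mem_varIdeal_of_mul_mem_irredIdeal (irredInter_le ha hf) ?_
    rw [monomial_mem_irredIdeal_iff, not_not, hwc le_rfl]
    exact ExpTuple.mem_box_of_le hca a.socleExp_mem_box
  · rintro _ ⟨j, hj, rfl⟩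
    rw [SetLike.mem_coe, Submodule.mem_colon_singleton, smul_eq_mul, X, monomial_mul, one_mul,
      monomial_mem_irredInter_iff one_ne_zero, add_left_comm]
    rintro b hb hcb
    rcases lt_or_ge a.1 b.1 with hab | hba
    · exact hwE b hb hab _ hcb
    · refine hc.not_prop_of_gt (y := Finsupp.single j 1 + c) (by simp [pos_iff_ne_zero]) ?_
      refine mem_standardExps_of_le hc.prop le_add_self ?_ ⟨b, hb, hba, (hwc hba _).1 hcb⟩
      rw [Finsupp.filter_add, filter_eq_of_mem_standardExps hc.prop,
        Finsupp.filter_single_of_pos (· ≤ a.1) hj]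

lemma exists_eq_varIdeal_of_eq_colon {p : Ideal (MvPolynomial (Fin n) K)} [p.IsPrime]
    {g : MvPolynomial (Fin n) K} (hp : p = (irredInter K E).colon {g}) :
    ∃ s, (standardExps E s).Nonempty ∧ p = varIdeal K s := by
  have hle {a : ExpTuple n} (ha : a ∈ E) {f : MvPolynomial (Fin n) K} (hf : f ∈ p) :
      f * g ∈ irredIdeal K a := by
    rw [hp, Submodule.mem_colon_singleton] at hf
    exact irredInter_le ha hf
  obtain ⟨a, ha, hap⟩ : ∃ a ∈ E, (irredIdeal K a).colon {g} ≤ p := by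
    rw [← Ideal.IsPrime.inf_le' ‹_›, Finset.inf_eq_iInf, hp, irredInter]
    simp only [Submodule.iInf_colon, le_refl]
  have hga : g ∉ irredIdeal K a := fun hg => by
    refine Ideal.IsPrime.ne_top ‹_› (top_le_iff.1 (le_trans (fun f _ => ?_) hap))
    exact Submodule.mem_colon_singleton.2 (Ideal.mul_mem_left _ _ hg)
  have hpa : p = varIdeal K a.1 := by
    refine le_antisymm (fun f hf => mem_varIdeal_of_mul_mem_irredIdeal (hle ha hf) hga) ?_
    rw [← radical_irredIdeal, Ideal.IsPrime.radical_le_iff ‹_›]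
    exact fun f hf => hap (Submodule.mem_colon_singleton.2 (Ideal.mul_mem_right _ _ hf))
  have hgb {b : ExpTuple n} (hb : b ∈ E) (hba : b.1 < a.1) : g ∈ irredIdeal K b := by
    by_contra hg
    refine hba.not_ge (X_mem_varIdeal_iff.1 (mem_varIdeal_of_mul_mem_irredIdeal (hle hb ?_) hg))
    exact hpa ▸ X_mem_varIdeal_iff.2 le_rfl
  obtain ⟨u, hu, hua⟩ : ∃ u ∈ g.support, u ∈ a.box := by simpa [mem_irredIdeal_iff] using hga
  exact ⟨a.1, ⟨_, filter_mem_standardExps_iff.2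
    ⟨⟨a, ha, rfl, hua⟩, fun b hb hba => mem_irredIdeal_iff.1 (hgb hb hba) u hu⟩⟩, hpa⟩

lemma mem_associatedPrimes_irredInter_iff {p : Ideal (MvPolynomial (Fin n) K)} :
    p ∈ associatedPrimes (MvPolynomial (Fin n) K) (MvPolynomial (Fin n) K ⧸ irredInter K E) ↔
      ∃ s, (standardExps E s).Nonempty ∧ p = varIdeal K s := by
  rw [AssociatedPrimes.mem_iff, isAssociatedPrime_quotient_iff]
  constructor
  · rintro ⟨_, g, hg⟩
    exact exists_eq_varIdeal_of_eq_colon hg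
  · rintro ⟨s, hs, rfl⟩
    obtain ⟨c, hc⟩ := (standardExps E s).exists_maximal hs
    obtain ⟨w, hw, hwE⟩ := exists_forall_add_notMem_box E s
    exact ⟨inferInstance, _, (colon_irredInter_of_maximal hc hw hwE).symm⟩

end AssociatedPrimes

section Height

variable {K : Type*} [Field K] {n : ℕ} {E : Finset (ExpTuple n)} {a : ExpTuple n}

lemma varIdeal_le_radical_irredInter {s : Fin n} (h : ∀ b ∈ E, s ≤ b.1) :
    varIdeal K s ≤ (irredInter K E).radical := by
  rw [irredInter, ← Finset.inf_eq_iInf, ← Ideal.radicalInfTopHom_apply, map_finset_inf]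
  refine Finset.le_inf fun b hb => ?_
  rw [Function.comp_apply, Ideal.radicalInfTopHom_apply, radical_irredIdeal]
  exact varIdeal_le_varIdeal_iff.2 (h b hb)

lemma radical_irredInter (ha : a ∈ E) (hmin : ∀ b ∈ E, a.1 ≤ b.1) :
    (irredInter K E).radical = varIdeal K a.1 := by
  refine le_antisymm ?_ (varIdeal_le_radical_irredInter hmin)
  rw [← radical_irredIdeal]
  exact Ideal.radical_mono (irredInter_le ha)

lemma height_irredInter (ha : a ∈ E) (hmin : ∀ b ∈ E, a.1 ≤ b.1) :
    (irredInter K E).height = a.1 + 1 := by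
  rw [Ideal.height_eq_inf_minimalPrimes, ← Ideal.radical_minimalPrimes, radical_irredInter ha hmin,
    ← Ideal.height_eq_inf_minimalPrimes, height_varIdeal]

end Height

section Hilbert

variable {K : Type*} [Field K] {n : ℕ}

lemma hilbertFunction_eq_ncard {I : Ideal (MvPolynomial (Fin n) K)}
    (hI : ∀ f ∈ I, ∀ u ∈ f.support, monomial u 1 ∈ I) (k : ℕ) :
    hilbertFunction I k = {u : Fin n →₀ ℕ | u.degree = k ∧ monomial u (1 : K) ∉ I}.ncard := by
  set B := {u : Fin n →₀ ℕ | u.degree = k ∧ monomial u (1 : K) ∉ I}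
  let π := (Ideal.Quotient.mkₐ K I).toLinearMap
  have hπ (f) : π f = 0 ↔ f ∈ I := Ideal.Quotient.eq_zero_iff_mem
  have hmap : (homogeneousSubmodule (Fin n) K k).map π = (restrictSupport K B).map π := by
    have hhom : homogeneousSubmodule (Fin n) K k = restrictSupport K {u | u.degree = k} :=
      homogeneousSubmodule_eq_finsupp_supported _ _ k
    rw [hhom]
    refine le_antisymm ?_ (Submodule.map_mono (restrictSupport_mono K fun u hu => hu.1))
    rw [restrictSupport_eq_span, Submodule.map_span_le]
    rintro _ ⟨u, hu, rfl⟩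
    by_cases huI : monomial u 1 ∈ I
    · exact (hπ _).2 huI ▸ zero_mem _
    · exact Submodule.mem_map_of_mem ((monomial_mem_restrictSupport K).2 (Or.inl ⟨hu, huI⟩))
  have hinj : Function.Injective (π.domRestrict (restrictSupport K B)) := by
    refine (injective_iff_map_eq_zero _).2 fun f hf => Subtype.ext (support_eq_empty.1 ?_)
    refine Finset.eq_empty_of_forall_notMem fun u hu => (f.2 hu).2 ?_
    exact hI f ((hπ f).1 hf) u hu
  rw [hilbertFunction, hmap, ← LinearMap.range_domRestrict, LinearMap.finrank_range_of_inj hinj,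
    Module.finrank_eq_nat_card_basis (basisRestrictSupport K B), Nat.card_coe_set_eq]

lemma degree_eq_of_isHilbertSamuelPoly {I : Ideal (MvPolynomial (Fin n) K)} {P : Polynomial ℚ}
    (hP : IsHilbertSamuelPoly I P) : degree I = P.natDegree.factorial * P.leadingCoeff := by
  have h : ∃ P, IsHilbertSamuelPoly I P := ⟨P, hP⟩
  have heq : h.choose = P := by
    refine Polynomial.eq_of_infinite_eval_eq _ _ ?_
    obtain ⟨N, hN⟩ := Filter.eventually_atTop.1 (hP.and h.choose_spec)
    refine Set.Infinite.mono (s := (Nat.cast : ℕ → ℚ) '' Set.Ici N) ?_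
      ((Set.Ici_infinite N).image Nat.cast_injective.injOn)
    rintro _ ⟨k, hk, rfl⟩
    exact (hN k hk).2.symm.trans (hN k hk).1
  rw [degree, dif_pos h, heq]

lemma ncard_degree_eq_filter_eq {s : Fin n} {c : Fin n →₀ ℕ} (hc : c.filter (· ≤ s) = c) (k : ℕ) :
    {u : Fin n →₀ ℕ | u.degree = c.degree + k ∧ u.filter (· ≤ s) = c}.ncard =
      (n - (s + 1)).multichoose k := by
  classical
  have hset : {u : Fin n →₀ ℕ | u.degree = c.degree + k ∧ u.filter (· ≤ s) = c} =
      (c + ·) '' ((Finset.Ioi s).finsuppAntidiag k : Set (Fin n →₀ ℕ)) := by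
    ext u
    simp only [Set.mem_ofPred_eq, Set.mem_image, SetLike.mem_coe, Finset.mem_finsuppAntidiag']
    constructor
    · rintro ⟨hdeg, hu⟩
      have hadd : c + u.filter (¬ · ≤ s) = u := hu ▸ Finsupp.filter_add_filter_not u (· ≤ s)
      refine ⟨u.filter (¬ · ≤ s), ⟨?_, fun j hj => ?_⟩, hadd⟩
      · rw [← hadd, map_add] at hdeg
        exact Nat.add_left_cancel hdeg
      · rw [Finsupp.support_filter, Finset.mem_filter, not_le] at hj
        exact Finset.mem_Ioi.2 hj.2
    · rintro ⟨v, ⟨rfl, hv⟩, rfl⟩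
      refine ⟨map_add _ _ _, ?_⟩
      rw [Finsupp.filter_add, hc, add_eq_left, Finsupp.filter_eq_zero_iff]
      intro j hj
      by_contra hvj
      exact hj.not_gt (Finset.mem_Ioi.1 (hv (Finsupp.mem_support_iff.2 hvj)))
  rw [hset, Set.ncard_image_of_injective _ (add_right_injective c), Set.ncard_coe_finset,
    Finset.card_finsuppAntidiag_nat_eq_multichoose, Fin.card_Ioi, Nat.sub_sub, add_comm 1]

lemma sum_ncard_degree_eq_filter_eq {s : Fin n} {c : Fin n →₀ ℕ} (hc : c.filter (· ≤ s) = c)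
    {k : ℕ} (hk : c.degree ≤ k) :
    ∑ j ∈ Finset.range (k + 1), {u : Fin n →₀ ℕ | u.degree = j ∧ u.filter (· ≤ s) = c}.ncard =
      (k - c.degree + (n - (s + 1))).choose (n - (s + 1)) := by
  obtain ⟨d, rfl⟩ := Nat.exists_eq_add_of_le hk
  rw [add_assoc, Finset.sum_range_add, Finset.sum_eq_zero fun j hj => ?_, zero_add,
    add_tsub_cancel_left, ← Nat.sum_range_multichoose]
  · exact Finset.sum_congr rfl fun i _ => ncard_degree_eq_filter_eq hc i
  · refine (Set.ncard_eq_zero ((Finsupp.finite_of_degree_eq j).subset fun _ h => h.1)).2 ?_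
    refine Set.eq_empty_iff_forall_notMem.2 fun u hu => ?_
    have := Finsupp.degree_mono (hu.2 ▸ filter_le_self (· ≤ s) u)
    have := Finset.mem_range.1 hj
    have := hu.1
    omega

variable {E : Finset (ExpTuple n)}

lemma hilbertFunction_irredInter (k : ℕ) : hilbertFunction (irredInter K E) k =
    ∑ p ∈ Finset.univ.sigma (standardExps E),
      {u : Fin n →₀ ℕ | u.degree = k ∧ u.filter (· ≤ p.1) = p.2}.ncard := by
  rw [hilbertFunction_eq_ncard, ← finsum_mem_coe_finset, ← Set.Finite.ncard_biUnion]
  · congr 1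
    ext u
    simp only [monomial_mem_irredInter_iff one_ne_zero, not_forall, not_not, exists_prop,
      ← exists_filter_mem_standardExps_iff, Set.mem_ofPred_eq, Set.mem_iUnion]
    constructor
    · rintro ⟨hk, s, hs⟩
      exact ⟨⟨s, _⟩, Finset.mem_sigma.2 ⟨Finset.mem_univ _, hs⟩, hk, rfl⟩
    · rintro ⟨p, hp, hk, hup⟩
      exact ⟨hk, p.1, hup ▸ (Finset.mem_sigma.1 hp).2⟩
  · exact Finset.finite_toSet _
  · exact fun p _ => (Finsupp.finite_of_degree_eq k).subset fun u hu => hu.1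
  · intro p hp q hq hpq
    refine Set.disjoint_left.2 fun u hup huq => hpq ?_
    have hs : p.1 = q.1 := eq_of_filter_mem_standardExps
      (hup.2 ▸ (Finset.mem_sigma.1 hp).2) (huq.2 ▸ (Finset.mem_sigma.1 hq).2)
    refine Sigma.ext hs (heq_of_eq ?_)
    rw [← hup.2, ← huq.2, hs]
  · intro f hf u hu
    exact (monomial_mem_irredInter_iff one_ne_zero).2 (mem_irredInter_iff.1 hf u hu)

lemma isHilbertSamuelPoly_irredInter : IsHilbertSamuelPoly (irredInter K E)
    (∑ p ∈ Finset.univ.sigma (standardExps E),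
      Polynomial.preHilbertPoly ℚ (n - (p.1 + 1)) p.2.degree) := by
  refine Filter.eventually_atTop.2 ⟨(Finset.univ.sigma (standardExps E)).sup (·.2.degree),
    fun k hk => ?_⟩
  simp_rw [hilbertFunction_irredInter]
  rw [Finset.sum_comm, Polynomial.eval_finsetSum, Nat.cast_sum]
  refine Finset.sum_congr rfl fun p hp => ?_
  have hpk : p.2.degree ≤ k := (Finset.le_sup (f := (·.2.degree)) hp).trans hk
  rw [sum_ncard_degree_eq_filter_eq (filter_eq_of_mem_standardExps (Finset.mem_sigma.1 hp).2) hpk,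
    Polynomial.preHilbertPoly_eq_choose_sub_add ℚ _ hpk]

end Hilbert

section LeadingCoeff

open Polynomial in
lemma factorial_natDegree_mul_leadingCoeff_sum_preHilbertPoly {F ι : Type*} [Field F] [CharZero F]
    {T : Finset ι} {d : ι → ℕ} {D : ℕ} (hle : ∀ i ∈ T, d i ≤ D) (hD : ∃ i ∈ T, d i = D)
    (e : ι → ℕ) :
    ((∑ i ∈ T, preHilbertPoly F (d i) (e i)).natDegree.factorial : F) *
      (∑ i ∈ T, preHilbertPoly F (d i) (e i)).leadingCoeff = (T.filter (d · = D)).card := by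
  set P := ∑ i ∈ T, preHilbertPoly F (d i) (e i)
  have hcoeff : P.coeff D = (T.filter (d · = D)).card * (D.factorial : F)⁻¹ := by
    rw [finsetSum_coeff, Finset.card_filter, Nat.cast_sum, Finset.sum_mul]
    refine Finset.sum_congr rfl fun i hi => ?_
    split_ifs with h
    · rw [← h, coeff_preHilbertPoly_self, Nat.cast_one, one_mul]
    · rw [Nat.cast_zero, zero_mul, coeff_eq_zero_of_natDegree_lt]
      exact (natDegree_preHilbertPoly _ _ _).trans_lt ((hle i hi).lt_of_ne h)
  have hfact : (D.factorial : F) ≠ 0 := by exact_mod_cast D.factorial_ne_zero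
  have hcard : ((T.filter (d · = D)).card : F) ≠ 0 := by
    simpa [Finset.filter_eq_empty_iff] using hD
  have hdeg : P.natDegree = D := natDegree_eq_of_le_of_coeff_ne_zero
    (natDegree_sum_le_of_forall_le _ _ fun i hi => by
      rw [natDegree_preHilbertPoly]; exact hle i hi)
    (hcoeff ▸ mul_ne_zero hcard (inv_ne_zero hfact))
  rw [leadingCoeff, hdeg, hcoeff, mul_comm, inv_mul_cancel_right₀ hfact]

end LeadingCoeff

section Degree

variable {K : Type*} [Field K] {n : ℕ} {E : Finset (ExpTuple n)} {a : ExpTuple n}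

lemma degree_irredInter_empty : degree (irredInter K (∅ : Finset (ExpTuple n))) = 0 := by
  rw [degree_eq_of_isHilbertSamuelPoly isHilbertSamuelPoly_irredInter,
    Finset.sum_eq_zero fun p hp => ?_]
  · simp
  · exact absurd (Finset.mem_sigma.1 hp).2 (by simp [mem_standardExps])

lemma degree_irredInter (ha : a ∈ E) (hmin : ∀ b ∈ E, a.1 ≤ b.1) :
    degree (irredInter K E) = (standardExps E a.1).card := by
  rw [degree_eq_of_isHilbertSamuelPoly isHilbertSamuelPoly_irredInter,
    factorial_natDegree_mul_leadingCoeff_sum_preHilbertPoly (D := n - (a.1 + 1))]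
  · refine congrArg Nat.cast ?_
    rw [← Finset.card_map (Function.Embedding.sigmaMk (β := fun _ => Fin n →₀ ℕ) a.1)]
    congr 1
    ext ⟨s, c⟩
    rw [Finset.mem_filter, Finset.mem_sigma, Finset.mem_map]
    constructor
    · rintro ⟨⟨-, hc⟩, hs⟩
      obtain rfl : s = a.1 := by dsimp only at hs; omega
      exact ⟨c, hc, rfl⟩
    · rintro ⟨c, hc, h⟩
      cases h
      exact ⟨⟨Finset.mem_univ _, hc⟩, rfl⟩
  · rintro p hp
    obtain ⟨⟨b, hb, hbp, -⟩, -⟩ := mem_standardExps.1 (Finset.mem_sigma.1 hp).2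
    have := Fin.le_def.1 (hbp ▸ hmin b hb)
    omega
  · refine ⟨⟨a.1, a.socleExp⟩, Finset.mem_sigma.2 ⟨Finset.mem_univ _, ?_⟩, rfl⟩
    exact mem_standardExps.2 ⟨⟨a, ha, rfl, le_rfl⟩, fun b hb hba => absurd hba (hmin b hb).not_gt⟩

lemma degree_varIdeal (s : Fin n) : degree (varIdeal K s) = 1 := by
  let a : ExpTuple n := ⟨s, fun _ => 1⟩
  have hsocle : a.socleExp = 0 := by ext; simp [ExpTuple.socleExp, a]
  have hstd : standardExps {a} s = {0} := by
    ext c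
    simp [mem_standardExps, hsocle, a]
  have hI : varIdeal K s = irredInter K {a} := by
    ext f
    simp [mem_varIdeal_iff, mem_irredInter_iff, ExpTuple.box, hsocle, a, pos_iff_ne_zero]
  rw [hI, degree_irredInter (Finset.mem_singleton_self a) (by simp), hstd, Finset.card_singleton,
    Nat.cast_one]

end Degree

section LengthMultiplicity

lemma mk_mem_span_mk_image_iff {R ι : Type*} [CommRing R] {I : Ideal R} {x : ι → R} {C : Set ι}
    {f : R} : Ideal.Quotient.mk I f ∈ Submodule.span R ((fun c => Ideal.Quotient.mk I (x c)) '' C) ↔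
      f ∈ I ⊔ Ideal.span (x '' C) := by
  rw [← Submodule.comap_map_mkQ, Submodule.mem_comap, Ideal.span, Submodule.map_span,
    Set.image_image]
  rfl

variable {K : Type*} [Field K] {n : ℕ} {E : Finset (ExpTuple n)} {s : Fin n} {c : Fin n →₀ ℕ}
  {f r : MvPolynomial (Fin n) K}

lemma mem_irredInter_sup_span_monomial_image_iff {C : Set (Fin n →₀ ℕ)} :
    f ∈ irredInter K E ⊔ Ideal.span ((monomial · 1) '' C) ↔
      ∀ u ∈ f.support, (∃ a ∈ E, u ∈ a.box) → ∃ c ∈ C, c ≤ u := by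
  rw [mem_sup_span_monomial_image_iff fun g hg u hu =>
    (monomial_mem_irredInter_iff one_ne_zero).2 (mem_irredInter_iff.1 hg u hu)]
  refine forall₂_congr fun u _ => ?_
  rw [monomial_mem_irredInter_iff one_ne_zero, or_iff_not_imp_left]
  push Not
  rfl

lemma mem_irredIdeal_of_mul_mem {a : ExpTuple n} (hr : r ∉ varIdeal K s) (ha : a.1 ≤ s)
    (h : r * f ∈ irredIdeal K a) : f ∈ irredIdeal K a := by
  by_contra hf
  exact hr (varIdeal_le_varIdeal_iff.2 ha (mem_varIdeal_of_mul_mem_irredIdeal h hf))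

lemma exists_monomial_notMem_varIdeal (E : Finset (ExpTuple n)) (s : Fin n) :
    ∃ w, monomial w (1 : K) ∉ varIdeal K s ∧
      ∀ b ∈ E, ∀ u, w + u ∈ b.box → b.1 ≤ s ∧ u ∈ b.box := by
  obtain ⟨w, hw, hwE⟩ := exists_forall_add_notMem_box E s
  refine ⟨w, ?_, fun b hb u hu => ⟨not_lt.1 fun h => hwE b hb h u hu,
    ExpTuple.mem_box_of_le le_add_self hu⟩⟩
  classical simpa [mem_varIdeal_iff, support_monomial] using hw

lemma exists_mul_mem_irredInter_iff :
    (∃ r ∉ varIdeal K s, r * f ∈ irredInter K E) ↔ ∀ a ∈ E, a.1 ≤ s → f ∈ irredIdeal K a := by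
  constructor
  · rintro ⟨r, hr, hrf⟩ a ha has
    exact mem_irredIdeal_of_mul_mem hr has (irredInter_le ha hrf)
  · intro h
    obtain ⟨w, hw, hwE⟩ := exists_monomial_notMem_varIdeal (K := K) E s
    refine ⟨_, hw, ?_⟩
    simp only [irredInter, Ideal.mem_iInf, monomial_mul_mem_irredIdeal_iff]
    intro a ha u hu hwu
    obtain ⟨has, hua⟩ := hwE a ha u hwu
    exact mem_irredIdeal_iff.1 (h a ha has) u hu hua

lemma exists_forall_mem_pow_exists_mul_mem_irredInter_iff :
    (∃ k : ℕ, ∀ r ∈ varIdeal K s ^ k, ∃ t ∉ varIdeal K s, t * (r * f) ∈ irredInter K E) ↔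
      ∀ a ∈ E, a.1 < s → f ∈ irredIdeal K a := by
  simp_rw [exists_mul_mem_irredInter_iff]
  constructor
  · rintro ⟨k, hk⟩ a ha has
    by_contra hf
    have hX : X s ^ k * f ∈ irredIdeal K a :=
      hk _ (Ideal.pow_mem_pow (X_mem_varIdeal_iff.2 le_rfl) k) a ha has.le
    have := Ideal.IsPrime.mem_of_pow_mem inferInstance k (mem_varIdeal_of_mul_mem_irredIdeal hX hf)
    exact has.not_ge (X_mem_varIdeal_iff.1 this)
  · intro h
    obtain ⟨k, hk⟩ := Ideal.exists_pow_le_of_le_radical_of_fg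
      (varIdeal_le_radical_irredInter (K := K) (E := {a ∈ E | a.1 = s}) (s := s) (by simp_all))
      (IsNoetherian.noetherian (varIdeal K s))
    refine ⟨k, fun r hr a ha has => ?_⟩
    rcases has.lt_or_eq with hlt | heq
    · exact Ideal.mul_mem_left _ _ (h a ha hlt)
    · exact Ideal.mul_mem_right _ _ (irredInter_le (Finset.mem_filter.2 ⟨ha, heq⟩) (hk hr))

lemma exists_mul_mem_irredInter_sup_span_standardExps_iff :
    (∃ r ∉ varIdeal K s,
      r * f ∈ irredInter K E ⊔ Ideal.span ((monomial · 1) '' (standardExps E s : Set _))) ↔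
      ∀ a ∈ E, a.1 < s → f ∈ irredIdeal K a := by
  constructor
  · rintro ⟨r, hr, hrf⟩ a ha has
    refine mem_irredIdeal_of_mul_mem hr has.le (sup_le (irredInter_le ha) (Ideal.span_le.2 ?_) hrf)
    rintro _ ⟨c, hc, rfl⟩
    exact monomial_mem_irredIdeal_iff.2 ((mem_standardExps.1 hc).2 a ha has)
  · intro h
    obtain ⟨w, hw, hwE⟩ := exists_monomial_notMem_varIdeal (K := K) E s
    refine ⟨_, hw, mem_irredInter_sup_span_monomial_image_iff.2 ?_⟩
    rw [support_monomial_one_mul, Finset.forall_mem_map]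
    rintro u hu ⟨a, ha, hwu⟩
    obtain ⟨has, hua⟩ := hwE a ha u hwu
    have hlt : ∀ b ∈ E, b.1 < s → u ∉ b.box := fun b hb hbs =>
      mem_irredIdeal_iff.1 (h b hb hbs) u hu
    refine ⟨u.filter (· ≤ s), filter_mem_standardExps_iff.2
      ⟨⟨a, ha, has.eq_of_not_lt fun h => hlt a ha h hua, hua⟩, hlt⟩, ?_⟩
    exact (filter_le_self _ u).trans le_add_self

lemma exists_mul_X_mul_monomial_mem_sup_span_gt (hc : c ∈ standardExps E s) {j : Fin n}
    (hj : j ≤ s) :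
    ∃ r ∉ varIdeal K s, r * (X j * monomial c 1) ∈
      irredInter K E ⊔ Ideal.span ((monomial · 1) '' {c' | c' ∈ standardExps E s ∧ c < c'}) := by
  obtain ⟨w, hw, hwE⟩ := exists_monomial_notMem_varIdeal (K := K) E s
  refine ⟨_, hw, mem_irredInter_sup_span_monomial_image_iff.2 fun u hu => ?_⟩
  rw [X, monomial_mul, monomial_mul] at hu
  obtain rfl := Finset.mem_singleton.1 (support_monomial_subset hu)
  rintro ⟨b, hb, hub⟩
  refine ⟨Finsupp.single j 1 + c, ⟨?_, by simp [pos_iff_ne_zero]⟩, le_add_self⟩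
  refine mem_standardExps_of_le hc le_add_self ?_ ⟨b, hb, hwE b hb _ hub⟩
  rw [Finsupp.filter_add, filter_eq_of_mem_standardExps hc,
    Finsupp.filter_single_of_pos (· ≤ s) hj]

lemma mul_monomial_notMem_sup_span_not_le (hc : c ∈ standardExps E s) (hr : r ∉ varIdeal K s) :
    r * monomial c 1 ∉
      irredInter K E ⊔ Ideal.span ((monomial · 1) '' {c' | c' ∈ standardExps E s ∧ ¬ c' ≤ c}) := by
  rw [mul_comm, mem_irredInter_sup_span_monomial_image_iff, support_monomial_one_mul,
    Finset.forall_mem_map]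
  intro h
  obtain ⟨u, hu, hus⟩ : ∃ u ∈ r.support, ∀ j ≤ s, u j = 0 := by simpa [mem_varIdeal_iff] using hr
  obtain ⟨a, ha, rfl, hca⟩ := (mem_standardExps.1 hc).1
  obtain ⟨c', ⟨hc', hc'c⟩, hle⟩ :=
    h u hu ⟨a, ha, fun j hj => by simpa [hus j hj] using hca j⟩
  refine hc'c fun j => ?_
  rcases le_or_gt j a.1 with hj | hj
  · simpa [hus j hj] using hle j
  · simp [apply_eq_zero_of_mem_standardExps hc' hj]

theorem lengthMult_varIdeal_quotient_irredInter (E : Finset (ExpTuple n)) (s : Fin n) :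
    lengthMult (varIdeal K s) (MvPolynomial (Fin n) K ⧸ irredInter K E) =
      (standardExps E s).card := by
  have hsmul (r f : MvPolynomial (Fin n) K) : r • Ideal.Quotient.mk (irredInter K E) f =
      Ideal.Quotient.mk (irredInter K E) (r * f) := rfl
  refine lengthMult_eq_card (p := varIdeal K s) (T := X '' Set.Iic s) rfl
    (fun c => Ideal.Quotient.mk (irredInter K E) (monomial c 1)) (standardExps E s) ?_ ?_ ?_
  · simp only [Ideal.Quotient.mk_surjective.forall, hsmul, mk_mem_span_mk_image_iff,
      Ideal.Quotient.eq_zero_iff_mem, exists_forall_mem_pow_exists_mul_mem_irredInter_iff,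
      exists_mul_mem_irredInter_sup_span_standardExps_iff, implies_true]
  · rintro c hc _ ⟨j, hj, rfl⟩
    simpa only [hsmul, mk_mem_span_mk_image_iff] using
      exists_mul_X_mul_monomial_mem_sup_span_gt hc hj
  · intro c hc r hr
    simpa only [hsmul, mk_mem_span_mk_image_iff] using mul_monomial_notMem_sup_span_not_le hc hr

end LengthMultiplicity

section Arithmetic

variable {K : Type*} [Field K] {n : ℕ} {E : Finset (ExpTuple n)}

lemma adegTerm_irredInter (E : Finset (ExpTuple n)) (s : Fin n) :
    adegTerm (irredInter K E) ⟨varIdeal K s, inferInstance⟩ = (standardExps E s).card := by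
  rw [adegTerm, lengthMult_varIdeal_quotient_irredInter, degree_varIdeal, mul_one,
    ENat.toNat_natCast]

lemma finsum_adegTerm_irredInter (E : Finset (ExpTuple n))
    (q : PrimeSpectrum (MvPolynomial (Fin n) K) → Prop) [DecidablePred q] :
    ∑ᶠ (p) (_ : p.asIdeal ∈ associatedPrimes (MvPolynomial (Fin n) K)
        (MvPolynomial (Fin n) K ⧸ irredInter K E) ∧ q p), adegTerm (irredInter K E) p =
      ∑ s with q ⟨varIdeal K s, inferInstance⟩, ((standardExps E s).card : ℚ) := by
  classical
  let P : Fin n ↪ PrimeSpectrum (MvPolynomial (Fin n) K) :=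
    ⟨fun s => ⟨varIdeal K s, inferInstance⟩, fun _ _ h => varIdeal_injective (congrArg (·.1) h)⟩
  have hmem (p) : p.asIdeal ∈ associatedPrimes (MvPolynomial (Fin n) K)
      (MvPolynomial (Fin n) K ⧸ irredInter K E) ∧ q p ↔
        p ∈ ({s | q (P s) ∧ (standardExps E s).Nonempty} : Finset (Fin n)).map P := by
    simp only [mem_associatedPrimes_irredInter_iff, Finset.mem_map, Finset.mem_filter,
      Finset.mem_univ, true_and]
    constructor
    · rintro ⟨⟨s, hs, hp⟩, hq⟩
      obtain rfl : P s = p := PrimeSpectrum.ext hp.symm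
      exact ⟨s, ⟨hq, hs⟩, rfl⟩
    · rintro ⟨s, ⟨hq, hs⟩, rfl⟩
      exact ⟨⟨s, hs, rfl⟩, hq⟩
  simp only [hmem]
  rw [finsum_mem_finset_eq_sum, Finset.sum_map, ← Finset.filter_filter]
  have hterm (s) : adegTerm (irredInter K E) (P s) = (standardExps E s).card :=
    adegTerm_irredInter E s
  simp_rw [hterm]
  refine Finset.sum_filter_of_ne fun s _ hs => ?_
  rwa [Nat.cast_ne_zero, Finset.card_ne_zero] at hs

theorem adeg_irredInter (E : Finset (ExpTuple n)) :
    adeg (irredInter K E) = ∑ s, ((standardExps E s).card : ℚ) := by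
  simpa [adeg] using finsum_adegTerm_irredInter (K := K) E fun _ => True

theorem adegAt_irredInter (E : Finset (ExpTuple n)) (i : ℕ) :
    adegAt (irredInter K E) i =
      ∑ s : Fin n with s.1 + 1 + i = n, ((standardExps E s).card : ℚ) := by
  classical
  rw [adegAt, finsum_adegTerm_irredInter]
  refine Finset.sum_congr (Finset.filter_congr fun s _ => ?_) fun _ _ => rfl
  rw [ringKrullDim_quotient_varIdeal]
  norm_cast
  omega

end Arithmetic

section StronglyStableIdeals

variable {K : Type*} [Field K] {n : ℕ} {E : Finset (ExpTuple n)}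
  {I : Ideal (MvPolynomial (Fin n) K)}

lemma IsStronglyStable.monomial_mem (hI : IsStronglyStable I) {v : Fin n →₀ ℕ} {i j : Fin n}
    (hji : j < i) (hv : monomial (v + Finsupp.single i 1) (1 : K) ∈ I) :
    monomial (v + Finsupp.single j 1) (1 : K) ∈ I := by
  have hmono {u w : Fin n →₀ ℕ} (hu : monomial u (1 : K) ∈ I) (h : u ≤ w) : monomial w 1 ∈ I :=
    I.mem_of_dvd (monomial_dvd_monomial.2 ⟨Or.inr h, one_dvd _⟩) hu
  obtain ⟨u, huv, hu⟩ := exists_minimal_le_of_wellFoundedLT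
    (fun u => monomial u (1 : K) ∈ I) _ hv
  by_cases hui : Finsupp.single i 1 ≤ u
  · refine hmono (hI.2 u hu i j (Nat.pos_of_ne_zero ?_) hji) ?_
    · simpa [Finsupp.single_le_iff, Nat.one_le_iff_ne_zero] using hui
    · exact add_le_add_left (tsub_le_iff_right.2 huv) _
  · refine hmono hu.prop (le_add_right fun k => ?_)
    rcases eq_or_ne k i with rfl | hk
    · simp_all
    · simpa [hk] using huv k

lemma IsIrredundantDecomposition.eq_of_box_subset_box (hE : IsIrredundantDecomposition I E)
    {a b : ExpTuple n} (ha : a ∈ E) (hb : b ∈ E) (h : a.box ⊆ b.box) : a = b := by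
  classical
  by_contra hab
  have hle : (⨅ b ∈ E.erase a, irredIdeal K b) ≤ irredIdeal K a :=
    (biInf_le _ (Finset.mem_erase.2 ⟨Ne.symm hab, hb⟩)).trans fun f hf =>
      mem_irredIdeal_iff.2 fun u hu hua => mem_irredIdeal_iff.1 hf u hu (h hua)
  refine hE.2 _ (Finset.erase_ssubset ha) ?_
  rw [hE.1, ← inf_eq_right.2 hle, ← Finset.iInf_insert, Finset.insert_erase ha]

end StronglyStableIdeals

section Corners

variable {n : ℕ} {E : Finset (ExpTuple n)} {s : Fin n} {a b : ExpTuple n} {k l : ℕ}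

lemma update_socleExp_mem_standardExps (hE : ∀ a ∈ E, ∀ b ∈ E, a.box ⊆ b.box → a = b) (ha : a ∈ E)
    (hk : k < a.e) : a.socleExp.update a.1 k ∈ standardExps E a.1 := by
  refine mem_standardExps.2 ⟨⟨a, ha, rfl, fun j => ?_⟩, fun b hb hba h => ?_⟩
  · rw [a.e_eq_socleExp_add_one, Nat.lt_succ_iff] at hk
    rw [Finsupp.coe_update, Function.update_apply]
    split_ifs with hj
    · rwa [hj]
    · rfl
  · refine hba.ne' (congrArg Sigma.fst (hE a ha b hb (ExpTuple.box_subset_box hba.le ?_)))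
    intro j hj
    simpa [(hj.trans_lt hba).ne] using h j hj

lemma eq_of_update_socleExp_eq (hE : ∀ a ∈ E, ∀ b ∈ E, a.box ⊆ b.box → a = b) (ha : a ∈ E)
    (hb : b ∈ E) (has : a.1 = s) (hbs : b.1 = s)
    (h : a.socleExp.update s k = b.socleExp.update s l) : a = b := by
  wlog hle : a.socleExp s ≤ b.socleExp s generalizing a b k l
  · exact (this hb ha hbs has h.symm (le_of_not_ge hle)).symm
  refine hE a ha b hb (ExpTuple.box_subset_box (hbs.trans has.symm).le fun j _ => ?_)
  by_cases hj : j = s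
  · rwa [hj]
  · simpa [hj] using (DFunLike.congr_fun h j).le

lemma exists_add_single_mem_box
    (hex : ∀ v i j, j < i → (∃ a ∈ E, v + Finsupp.single j 1 ∈ a.box) →
      ∃ a ∈ E, v + Finsupp.single i 1 ∈ a.box) (ha : a ∈ E) {u : Fin n →₀ ℕ} {j : Fin n}
    (hj : j < a.1) (hu : u + Finsupp.single j 1 ∈ a.box) :
    ∃ b ∈ E, b.1 ≤ a.1 ∧ u + Finsupp.single a.1 1 ∈ b.box := by
  obtain ⟨w, hw, hwE⟩ := exists_forall_add_notMem_box E a.1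
  have hwu : w + u + Finsupp.single j 1 ∈ a.box :=
    (ExpTuple.mem_box_congr fun i hi => by simp [hw i hi]).2 hu
  obtain ⟨b, hb, hwb⟩ := hex _ _ j hj ⟨a, ha, hwu⟩
  rw [add_assoc] at hwb
  exact ⟨b, hb, not_lt.1 fun h => hwE b hb h _ hwb, ExpTuple.mem_box_of_le le_add_self hwb⟩

lemma exists_update_socleExp_eq
    (hex : ∀ v i j, j < i → (∃ a ∈ E, v + Finsupp.single j 1 ∈ a.box) →
      ∃ a ∈ E, v + Finsupp.single i 1 ∈ a.box) {c : Fin n →₀ ℕ} (hc : c ∈ standardExps E s) :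
    ∃ a ∈ E, a.1 = s ∧ ∃ k < a.e, a.socleExp.update s k = c := by
  obtain ⟨a, ⟨ha, rfl, hca⟩, hmax⟩ := Set.exists_max_image
    {a | a ∈ E ∧ a.1 = s ∧ c ≤ a.socleExp} (·.socleExp s)
    (E.finite_toSet.subset fun _ h => h.1) (mem_standardExps.1 hc).1
  refine ⟨a, ha, rfl, c a.1, ?_, ?_⟩
  · rw [a.e_eq_socleExp_add_one]
    exact Nat.lt_succ_of_le (hca a.1)
  by_contra hne
  obtain ⟨j, hj, hcj⟩ : ∃ j < a.1, c j < a.socleExp j := by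
    obtain ⟨j, hne⟩ := DFunLike.ne_iff.1 hne
    rcases lt_trichotomy j a.1 with hj | rfl | hj
    · exact ⟨j, hj, (hca j).lt_of_ne (by simpa [hj.ne, eq_comm] using hne)⟩
    · simp at hne
    · simp [hj.ne', a.socleExp_of_gt hj, apply_eq_zero_of_mem_standardExps hc hj] at hne
  have hua : c.update a.1 (a.socleExp a.1) + Finsupp.single j 1 ∈ a.box := fun i _ => by
    rcases eq_or_ne i a.1 with rfl | hia
    · simp [hj.ne']
    · rcases eq_or_ne i j with rfl | hij
      · simpa [hia] using hcj
      · simpa [hia, hij] using hca i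
  obtain ⟨b, hb, hba, hub⟩ := exists_add_single_mem_box hex ha hj hua
  have hcb : c ∈ b.box := by
    refine ExpTuple.mem_box_of_le (fun i => ?_) hub
    rcases eq_or_ne i a.1 with rfl | hia
    · simpa using (hca a.1).trans (Nat.le_succ _)
    · simp [hia]
  replace hba : b.1 = a.1 := hba.eq_of_not_lt fun h => (mem_standardExps.1 hc).2 b hb h hcb
  have hcb' : c ≤ b.socleExp := by
    rw [← filter_eq_of_mem_standardExps hc, ← hba]
    exact ExpTuple.filter_le_socleExp_iff.2 hcb
  have hlt : a.socleExp a.1 + 1 ≤ b.socleExp a.1 := by simpa using hub a.1 hba.ge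
  exact (hmax b ⟨hb, hba, hcb'⟩).not_gt hlt

theorem card_standardExps (hbox : ∀ a ∈ E, ∀ b ∈ E, a.box ⊆ b.box → a = b)
    (hex : ∀ v i j, j < i → (∃ a ∈ E, v + Finsupp.single j 1 ∈ a.box) →
      ∃ a ∈ E, v + Finsupp.single i 1 ∈ a.box) (s : Fin n) :
    (standardExps E s).card = ∑ a ∈ E with a.1 = s, a.e := by
  rw [← Finset.sum_congr rfl fun a _ => Finset.card_range a.e, ← Finset.card_sigma]
  refine (Finset.card_nbij (fun p => p.1.socleExp.update s p.2) ?_ ?_ ?_).symm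
  · rintro ⟨a, k⟩ hak
    simp only [Finset.mem_coe, Finset.mem_sigma, Finset.mem_filter, Finset.mem_range] at hak
    obtain ⟨⟨ha, rfl⟩, hk⟩ := hak
    exact update_socleExp_mem_standardExps hbox ha hk
  · rintro ⟨a, k⟩ hak ⟨b, l⟩ hbl h
    simp only [Finset.mem_coe, Finset.mem_sigma, Finset.mem_filter, Finset.mem_range] at hak hbl
    obtain rfl := eq_of_update_socleExp_eq hbox hak.1.1 hbl.1.1 hak.1.2 hbl.1.2 h
    have hkl : k = l := by simpa using DFunLike.congr_fun h s
    rw [hkl]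
  · intro c hc
    obtain ⟨a, ha, has, k, hk, rfl⟩ := exists_update_socleExp_eq hex hc
    exact ⟨⟨a, k⟩, by simp [ha, has, hk], rfl⟩

end Corners

section Main

variable {K : Type*} [Field K] {n : ℕ} {E : Finset (ExpTuple n)}

lemma IsStronglyStable.exists_add_single_mem_box (hI : IsStronglyStable (irredInter K E))
    (v : Fin n →₀ ℕ) (i j : Fin n) (hji : j < i) (h : ∃ a ∈ E, v + Finsupp.single j 1 ∈ a.box) :
    ∃ a ∈ E, v + Finsupp.single i 1 ∈ a.box := by
  contrapose! h
  rw [← monomial_mem_irredInter_iff (one_ne_zero (α := K))] at h ⊢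
  exact hI.monomial_mem hji h

lemma sum_card_standardExps_eq_sum_e
    (hcard : ∀ s, (standardExps E s).card = ∑ a ∈ E with a.1 = s, a.e)
    (q : Fin n → Prop) [DecidablePred q] :
    ∑ s with q s, ((standardExps E s).card : ℚ) = ∑ a ∈ E with q a.1, (a.e : ℚ) := by
  simp_rw [hcard, Nat.cast_sum]
  rw [Finset.sum_comm' (t' := {a ∈ E | q a.1}) (s' := fun a => {a.1})]
  · simp only [Finset.sum_singleton]
  · simp only [Finset.mem_filter, Finset.mem_univ, Finset.mem_singleton]
    grind

lemma degree_irredInter_eq_sum_e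
    (hcard : ∀ s, (standardExps E s).card = ∑ a ∈ E with a.1 = s, a.e) :
    degree (irredInter K E) =
      ∑ a ∈ E with (a.t : ℕ∞) = (irredInter K E).height, (a.e : ℚ) := by
  rcases E.eq_empty_or_nonempty with rfl | hE
  · rw [degree_irredInter_empty, Finset.filter_empty, Finset.sum_empty]
  obtain ⟨a, ha, hmin⟩ := E.exists_min_image Sigma.fst hE
  rw [degree_irredInter ha hmin, hcard, Nat.cast_sum, height_irredInter ha hmin]
  refine Finset.sum_congr (Finset.filter_congr fun b _ => ?_) fun _ _ => rfl
  rw [ExpTuple.t, ← Nat.cast_add_one, Nat.cast_inj, Nat.add_right_cancel_iff, Fin.ext_iff]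

end Main

end StronglyStable

theorem mainTheorem5 {K : Type*} [Field K] {n : ℕ} (I : Ideal (MvPolynomial (Fin n) K))
    (hI : StronglyStable.IsStronglyStable I) (E : Finset (StronglyStable.ExpTuple n))
    (hE : StronglyStable.IsIrredundantDecomposition I E) :
    (∀ i : ℕ, StronglyStable.adegAt I i = ∑ a ∈ E with a.t + i = n, (a.e : ℚ)) ∧
    StronglyStable.adeg I = ∑ a ∈ E, (a.e : ℚ) ∧
    StronglyStable.degree I = ∑ a ∈ E with (a.t : ℕ∞) = I.height, (a.e : ℚ) := by
  have hbox (a) (ha : a ∈ E) (b) (hb : b ∈ E) : a.box ⊆ b.box → a = b :=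
    hE.eq_of_box_subset_box ha hb
  obtain rfl : I = StronglyStable.irredInter K E := hE.1
  have hcard := StronglyStable.card_standardExps hbox hI.exists_add_single_mem_box
  refine ⟨fun i => ?_, ?_, StronglyStable.degree_irredInter_eq_sum_e hcard⟩
  · rw [StronglyStable.adegAt_irredInter,
      StronglyStable.sum_card_standardExps_eq_sum_e hcard (·.1 + 1 + i = n)]
    rfl
  · simpa [StronglyStable.adeg_irredInter] using
      StronglyStable.sum_card_standardExps_eq_sum_e hcard fun _ => True
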